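/- **Setting.** Let $Q\in\mathbb R^{n\times n}$ be positive semidefinite, $c,a_1,\dots,a_m\in\mathbb R^n$, $\mathcal B\subseteq[n]$ (the binary indices), and let $U_i\in\mathbb R$ for $i\in[n]\setminus\mathcal B$ (bounds on the continuous variables). For a vector $x\in\mathbb R^n$ and a matrix $X\in\mathbb R^{n\times n}$ put $Y=\begin{pmatrix}1&x^\top\\x&X\end{pmatrix}$. For real functions $b_1,\dots,b_m$ of a real parameter $\theta$, let $\mathcal P^{\rm SDP\text{-}bd}(\theta)$ be the problem $$\min\ \operatorname{Tr}(Q^\top X)+c^\top x\quad\text{s.t.}\quad a_j^\top x=b_j(\theta),\ \operatorname{Tr}(a_ja_j^\top X)=b_j(\theta)^2\ (j\in[m]),\quad x_i=X_{ii}\ (i\in\mathcal B),\quad X_{ii}\le U_i^2\ (i\notin\mathcal B),\quad Y\succeq 0,\ Y\ge 0\text{ entrywise},$$ and let $V^{\rm SDP}(\theta)$ be its optimal value. Its dual $\mathcal P^{\rm SDP\text{-}dual}(\theta)$ is to maximize, over tuples $\Psi=(\gamma,\omega,\varphi,\kappa,\mu,\Omega,\Theta)$ with $\gamma,\omega\in\mathbb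 R^m$, $\varphi\in\mathbb R^{[n]\setminus\mathcal B}$, $\kappa\in\mathbb R^{\mathcal B}$, $\mu\in\mathbb R$ and $\Omega,\Theta\in\mathbb R^{(n+1)\times(n+1)}$, $$f^{\rm d}(\Psi,\theta)=\sum_{j=1}^m\bigl(\gamma_jb_j(\theta)+\omega_jb_j(\theta)^2\bigr)+\sum_{i\notin\mathcal B}U_i^2\varphi_i+\mu$$ subject to $\varphi\le 0$, $\Theta\ge0$ entrywise, $\Omega\succeq0$ and $$\begin{pmatrix}-\mu&\tfrac12 r^\top\\ \tfrac12 r&R\end{pmatrix}=\Theta+\Omega,\qquad r=c-\sum_j\gamma_ja_j-\sum_{i\in\mathcal B}\kappa_ie_i,\quad R=Q-\sum_j\omega_ja_ja_j^\top+\sum_{i\in\mathcal B}\kappa_ie_ie_i^\top-\sum_{i\notin\mathcal B}\varphi_ie_ie_i^\top .$$ Thus the dual feasible set does not depend on $\theta$. **Theorem 1.** Let $[\underline\theta,\overline\theta]$ be an interval such that every $b_j$ is differentiable at every point of $[\underline\theta,\overline\theta]$ and $\mathcal P^{\rm SDP\text{-}bd}(t)$ is feasible for every $t\in[\underline\theta,\overline\theta]$.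 Then the minimum defining $V^{\rm SDP}(t)$ is attained for every $t\in[\underline\theta,\overline\theta]$. Moreover, let $\theta\in[\underline\theta,\overline\theta]$ and let $\Psi^*$ be any optimal solution of $\mathcal P^{\rm SDP\text{-}dual}(\theta)$. Then the derivative $f^{\rm d}_\theta(\Psi^*,\theta)$ of $f^{\rm d}(\Psi^*,\cdot)$ at $\theta$ exists, and: 1. if $\theta>\underline\theta$ and $V^{\rm SDP}$ is left differentiable at $\theta$, then $V^{\rm SDP\prime}(\theta-)\le f^{\rm d}_\theta(\Psi^*,\theta)$; 2. if $\theta<\overline\theta$ and $V^{\rm SDP}$ is right differentiable at $\theta$, then $V^{\rm SDP\prime}(\theta+)\ge f^{\rm d}_\theta(\Psi^*,\theta)$; 3. if $V^{\rm SDP}$ is (two-sidedly) differentiable at $\theta$, which presupposes that $\mathcal P^{\rm SDP\text{-}bd}(t)$ is feasible for all $t$ in a neighbourhood of $\theta$ (automatic for $\underline\theta<\theta<\overline\theta$), then $V^{\rm SDP\prime}(\theta)=f^{\rm d}_\theta(\Psi^*,\theta)$. -/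

import Mathlib

open Set Filter Topology Matrix

noncomputable section

/-- The data of a mixed-binary quadratic problem
`min xᵀQx + cᵀx  s.t.  a_jᵀ x = b_j, x ≥ 0, x_i ∈ {0,1} for i ∈ B`, other than its right-hand
sides `b`, together with upper bounds `U i` for the continuous variables `x_i`, `i ∉ B`. -/
structure MBQPData (n m : ℕ) where
  /-- objective matrix -/
  Q : Matrix (Fin n) (Fin n) ℝ
  /-- linear objective coefficients -/
  c : Fin n → ℝ
  /-- constraint coefficient vectors -/
  a : Fin m → Fin n → ℝ
  /-- indices of the binary variables -/
  B : Finset (Fin n)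
  /-- upper bounds of the continuous variables -/
  U : {i : Fin n // i ∉ B} → ℝ

/-- The symmetric `(1 + n) × (1 + n)` matrix with blocks `[[r, vᵀ], [v, M]]`. -/
def borderedMatrix {n : ℕ} (r : ℝ) (v : Fin n → ℝ) (M : Matrix (Fin n) (Fin n) ℝ) :
    Matrix (Unit ⊕ Fin n) (Unit ⊕ Fin n) ℝ :=
  Matrix.fromBlocks (Matrix.of fun _ _ => r) (Matrix.replicateRow Unit v)
    (Matrix.replicateCol Unit v) M

namespace MBQPData

variable {n m : ℕ}

/-! ### The strengthened semidefinite relaxation -/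

/-- Objective `Tr(Qᵀ X) + cᵀ x` of the relaxation. -/
def primalObj (P : MBQPData n m) (p : (Fin n → ℝ) × Matrix (Fin n) (Fin n) ℝ) : ℝ :=
  (P.Qᵀ * p.2).trace + P.c ⬝ᵥ p.1

/-- Feasible region of the relaxation with right-hand sides `b`; `p = (x, X)` stands for
`Y = [[1, xᵀ], [x, X]]`. -/
def primalFeas (P : MBQPData n m) (b : Fin m → ℝ) :
    Set ((Fin n → ℝ) × Matrix (Fin n) (Fin n) ℝ) :=
  {p | (∀ j, P.a j ⬝ᵥ p.1 = b j) ∧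
       (∀ j, (Matrix.vecMulVec (P.a j) (P.a j) * p.2).trace = b j ^ 2) ∧
       (∀ i ∈ P.B, p.1 i = p.2 i i) ∧
       (∀ i : {i : Fin n // i ∉ P.B}, p.2 i i ≤ P.U i ^ 2) ∧
       (borderedMatrix 1 p.1 p.2).PosSemidef ∧
       (∀ k l, 0 ≤ borderedMatrix 1 p.1 p.2 k l)}

/-- Optimal value of the relaxation with right-hand sides `b`. -/
def primalValue (P : MBQPData n m) (b : Fin m → ℝ) : ℝ :=
  sInf (P.primalObj '' P.primalFeas b)

/-! ### The dual problem -/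

/-- Dual variables: `γ` for `a_jᵀ x = b_j`, `ω` for `Tr(a_j a_jᵀ X) = b_j²`, `κ` for
`x_i = X_ii` (binary `i`), `φ` for `X_ii ≤ U_i²` (continuous `i`), `μ` for `Y₀₀ = 1`,
`Ω` for `Y ⪰ 0` and `Θ` for `Y ≥ 0`. -/
structure DualVar (P : MBQPData n m) where
  γ : Fin m → ℝ
  ω : Fin m → ℝ
  φ : {i : Fin n // i ∉ P.B} → ℝ
  κ : {i : Fin n // i ∈ P.B} → ℝ
  μ : ℝ
  Ω : Matrix (Unit ⊕ Fin n) (Unit ⊕ Fin n) ℝ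
  Θ : Matrix (Unit ⊕ Fin n) (Unit ⊕ Fin n) ℝ

/-- The dual slack matrix
`C - ∑ γ_j A_j - ∑ ω_j Â_j - ∑ κ_i B_i - ∑ φ_i G_i - μ H`, where the inner products of
`C, A_j, Â_j, B_i, G_i, H` with `Y` are
`Tr(QᵀX) + cᵀx`, `a_jᵀx`, `Tr(a_j a_jᵀ X)`, `x_i - X_ii`, `X_ii`, `Y₀₀`. -/
def dualSlack (P : MBQPData n m) (Ψ : P.DualVar) :
    Matrix (Unit ⊕ Fin n) (Unit ⊕ Fin n) ℝ :=
  borderedMatrix 0 ((1 / 2 : ℝ) • P.c) P.Q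
    - ∑ j, Ψ.γ j • borderedMatrix 0 ((1 / 2 : ℝ) • P.a j) 0
    - ∑ j, Ψ.ω j • borderedMatrix 0 0 (Matrix.vecMulVec (P.a j) (P.a j))
    - ∑ i, Ψ.κ i • borderedMatrix 0 ((1 / 2 : ℝ) • Pi.single (i : Fin n) (1 : ℝ))
        (-Matrix.single (i : Fin n) (i : Fin n) (1 : ℝ))
    - ∑ i, Ψ.φ i • borderedMatrix 0 0 (Matrix.single (i : Fin n) (i : Fin n) (1 : ℝ))
    - Ψ.μ • borderedMatrix 1 0 0

/-- Feasible region of the dual. It does not involve the right-hand sides `b`. -/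
def dualFeas (P : MBQPData n m) : Set P.DualVar :=
  {Ψ | P.dualSlack Ψ = Ψ.Θ + Ψ.Ω ∧ (∀ i, Ψ.φ i ≤ 0) ∧ (∀ k l, 0 ≤ Ψ.Θ k l) ∧ Ψ.Ω.PosSemidef}

/-- Dual objective at right-hand sides `b`. -/
def dualObj (P : MBQPData n m) (b : Fin m → ℝ) (Ψ : P.DualVar) : ℝ :=
  ∑ j, (Ψ.γ j * b j + Ψ.ω j * b j ^ 2) + ∑ i, P.U i ^ 2 * Ψ.φ i + Ψ.μ

/-- Set of optimal solutions of the dual (a maximization problem) at right-hand sides `b`. -/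
def dualOpt (P : MBQPData n m) (b : Fin m → ℝ) : Set P.DualVar :=
  {Ψ | Ψ ∈ P.dualFeas ∧ ∀ Ψ' ∈ P.dualFeas, P.dualObj b Ψ' ≤ P.dualObj b Ψ}

/-! ### Parametric right-hand sides -/

/-- Value function `V^SDP(θ)` of the relaxation with right-hand sides `b_j(θ)`. -/
def valueFun (P : MBQPData n m) (b : Fin m → ℝ → ℝ) (θ : ℝ) : ℝ :=
  P.primalValue (fun j => b j θ)

/-- Dual objective `f^d(Ψ, θ)` with right-hand sides `b_j(θ)`. -/
def dualFun (P : MBQPData n m) (b : Fin m → ℝ → ℝ) (Ψ : P.DualVar) (θ : ℝ) : ℝ :=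
  P.dualObj (fun j => b j θ) Ψ

/-- Parameters at which the relaxation with right-hand sides `b_j(θ)` is feasible. -/
def feasDomain (P : MBQPData n m) (b : Fin m → ℝ → ℝ) : Set ℝ :=
  {θ | (P.primalFeas (fun j => b j θ)).Nonempty}

end MBQPData

end

/-!
The dual feasible set does not depend on the parameter `θ`. Fix `θ` and a dual optimal solution
`Ψ` for it. By weak duality (`MBQPData.dualObj_le_primalValue`) the smooth function
`g = P.dualFun b Ψ` lies below the value function at every parameter where the relaxation is
feasible, and by strong duality (`MBQPData.dualObj_eq_primalValue`) the two agree at `θ`. So the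
value function minus `g` has a local minimum at `θ`, relative to the feasible parameters, and
comparing difference quotients on either side of `θ` gives the bounds on the derivatives.

The core is therefore strong duality, which needs no Slater condition because the relaxation has
no nonzero recession direction: if `Y ⪰ 0` satisfies the homogeneous constraints, its diagonal
vanishes, hence `Y = 0` (`MBQPData.eq_zero_of_constraintMap_eq_zero`). Consequently the image of
the cone under the constraint map is closed (`PointedCone.isClosed_image_of_ker_eq_zero`), and a
value `v` below the primal minimum can be separated from it. The separating functional, divided by
its positive coefficient at the objective, is a dual feasible point with value above `v`
(`MBQPData.exists_dualFeas_lt_dualObj`). The cone is taken in a lifted space with two copies of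
`Y`, one positive semidefinite and one nonnegative, so that the decomposition `Θ + Ω` of the dual
slack is read off directly, and closedness of the sum of the two dual cones is not needed.

The same control of `Y` by its diagonal makes the primal feasible region compact, so the minimum
is attained (`MBQPData.isLeast_primalValue`).
-/

/-! ### Linear images of closed cones -/

/-- A linear map that vanishes on a closed cone only at the origin maps it onto a closed set:
by compactness of the unit sphere the map is bounded below on the cone, so preimages of a
convergent sequence are bounded. -/
theorem PointedCone.isClosed_image_of_ker_eq_zero {W F : Type*} [NormedAddCommGroup W]
    [NormedSpace ℝ W] [FiniteDimensional ℝ W] [NormedAddCommGroup F] [NormedSpace ℝ F]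
    (K : PointedCone ℝ W) (hK : IsClosed (K : Set W)) (L : W →ₗ[ℝ] F)
    (hL : ∀ w ∈ K, L w = 0 → w = 0) : IsClosed (L '' (K : Set W)) := by
  have hLc : Continuous L := L.continuous_of_finiteDimensional
  have : ProperSpace W := FiniteDimensional.proper ℝ W
  obtain ⟨c, hc, hcL⟩ : ∃ c > 0, ∀ w ∈ K, c * ‖w‖ ≤ ‖L w‖ := by
    have hS : IsCompact ((K : Set W) ∩ Metric.sphere 0 1) := (isCompact_sphere 0 1).inter_left hK
    obtain ⟨c, hc, hcS⟩ : ∃ c > 0, ∀ w ∈ (K : Set W) ∩ Metric.sphere 0 1, c ≤ ‖L w‖ := by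
      refine hS.exists_forall_le' (a := 0) hLc.norm.continuousOn fun w hw ↦ ?_
      refine norm_pos_iff.2 fun h0 ↦ ?_
      have h1 := hw.2
      rw [hL w hw.1 h0] at h1
      simp at h1
    refine ⟨c, hc, fun w hw ↦ ?_⟩
    rcases eq_or_ne w 0 with rfl | h0
    · simp
    have hpos : 0 < ‖w‖ := norm_pos_iff.2 h0
    have := hcS (‖w‖⁻¹ • w) ⟨K.smul_mem (by positivity) hw, by simp [norm_smul, hpos.ne']⟩
    rwa [map_smul, norm_smul, norm_inv, norm_norm, le_inv_mul_iff₀ hpos, mul_comm] at this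
  refine isClosed_of_closure_subset fun z hz ↦ ?_
  obtain ⟨v, hv, hvz⟩ := mem_closure_iff_seq_limit.1 hz
  choose w hwK hwv using hv
  obtain ⟨R, hR⟩ := hvz.norm.bddAbove_range
  have hwR : ∀ k, w k ∈ Metric.closedBall 0 (R / c) := fun k ↦ by
    rw [mem_closedBall_zero_iff, le_div_iff₀ hc, mul_comm]
    exact (hcL _ (hwK k)).trans (by rw [hwv]; exact hR ⟨k, rfl⟩)
  obtain ⟨w₀, -, φ, hφ, hw₀⟩ := (isCompact_closedBall (0 : W) (R / c)).tendsto_subseq hwR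
  refine ⟨w₀, hK.mem_of_tendsto hw₀ (.of_forall fun k ↦ hwK _), ?_⟩
  refine tendsto_nhds_unique ((hLc.tendsto _).comp hw₀) ?_
  have hvw : L ∘ w ∘ φ = v ∘ φ := funext fun k ↦ hwv _
  rw [hvw]
  exact hvz.comp hφ.tendsto_atTop

/-- Farkas' lemma for the image of a closed cone, in coordinates. -/
theorem PointedCone.exists_separating_vector {W ι : Type*} [NormedAddCommGroup W]
    [NormedSpace ℝ W] [FiniteDimensional ℝ W] [Fintype ι]
    (K : PointedCone ℝ W) (hK : IsClosed (K : Set W)) (L : W →ₗ[ℝ] ι → ℝ)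
    (hL : ∀ w ∈ K, L w = 0 → w = 0) {z : ι → ℝ} (hz : ∀ w ∈ K, L w ≠ z) :
    ∃ y : ι → ℝ, (∀ w ∈ K, 0 ≤ ∑ i, L w i * y i) ∧ ∑ i, z i * y i < 0 := by
  classical
  let C : ProperCone ℝ (ι → ℝ) :=
    ⟨K.map L, by simpa using! K.isClosed_image_of_ker_eq_zero hK L hL⟩
  have hzC : z ∉ C := fun ⟨w, hw, h⟩ ↦ hz w hw h
  obtain ⟨f, hf, hfz⟩ := C.hyperplane_separation_point hzC
  have hfe : ∀ v, f v = ∑ i, v i * f (fun j ↦ if i = j then 1 else 0) :=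
    fun v ↦ (f : (ι → ℝ) →ₗ[ℝ] ℝ).pi_apply_eq_sum_univ v
  refine ⟨fun i ↦ f (fun j ↦ if i = j then 1 else 0), fun w hw ↦ ?_, ?_⟩
  · rw [← hfe]
    exact hf _ ⟨w, hw, rfl⟩
  · rwa [← hfe]

/-! ### Positive semidefinite matrices -/

namespace Matrix

variable {ι : Type*} [Fintype ι]

theorem PosSemidef.abs_apply_le {A : Matrix ι ι ℝ} (hA : A.PosSemidef) (k l : ι) :
    |A k l| ≤ (A k k + A l l) / 2 := by
  classical
  have hs : A l k = A k l := by simpa using hA.isHermitian.apply k l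
  have h1 := hA.dotProduct_mulVec_nonneg (Pi.single k 1 - Pi.single l 1)
  have h2 := hA.dotProduct_mulVec_nonneg (Pi.single k 1 + Pi.single l 1)
  simp [mulVec_sub, mulVec_add, sub_dotProduct, add_dotProduct, hs] at h1 h2
  rw [abs_le]
  constructor <;> linarith

theorem PosSemidef.eq_zero_of_diag_eq_zero {A : Matrix ι ι ℝ} (hA : A.PosSemidef)
    (h : ∀ k, A k k = 0) : A = 0 := by
  ext k l
  simpa [h] using hA.abs_apply_le k l

theorem isClosed_setOf_posSemidef : IsClosed {A : Matrix ι ι ℝ | A.PosSemidef} := by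
  simp only [posSemidef_iff_dotProduct_mulVec, ofPred_and, ofPred_forall, IsHermitian]
  exact (isClosed_eq (by fun_prop) (by fun_prop)).inter
    (isClosed_iInter fun v ↦ isClosed_le (by fun_prop) (by fun_prop))

theorem trace_transpose_mul_vecMulVec (A : Matrix ι ι ℝ) (v : ι → ℝ) :
    (Aᵀ * vecMulVec v v).trace = v ⬝ᵥ A *ᵥ v := by
  rw [mul_vecMulVec, trace_vecMulVec, mulVec_transpose, dotProduct_mulVec]

theorem PosSemidef.trace_transpose_mul_nonneg {A B : Matrix ι ι ℝ} (hA : A.PosSemidef)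
    (hB : B.PosSemidef) : 0 ≤ (Aᵀ * B).trace := by
  obtain ⟨k, v, rfl⟩ := posSemidef_iff_eq_sum_vecMulVec.1 hB
  rw [Finset.mul_sum, trace_sum]
  refine Finset.sum_nonneg fun i _ ↦ ?_
  rw [star_trivial, trace_transpose_mul_vecMulVec]
  simpa using hA.dotProduct_mulVec_nonneg (v i)

theorem trace_transpose_mul_eq_sum (A B : Matrix ι ι ℝ) :
    (Aᵀ * B).trace = ∑ k, ∑ l, A k l * B k l := by
  rw [Finset.sum_comm]
  simp [trace, mul_apply]

end Matrix

/-! ### Bordered matrices -/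

section BorderedMatrix

variable {n : ℕ}

theorem borderedMatrix_add (r s : ℝ) (v w : Fin n → ℝ) (M N : Matrix (Fin n) (Fin n) ℝ) :
    borderedMatrix (r + s) (v + w) (M + N) = borderedMatrix r v M + borderedMatrix s w N := by
  ext (_ | _) (_ | _) <;> simp [borderedMatrix]

theorem borderedMatrix_smul (t r : ℝ) (v : Fin n → ℝ) (M : Matrix (Fin n) (Fin n) ℝ) :
    borderedMatrix (t * r) (t • v) (t • M) = t • borderedMatrix r v M := by
  ext (_ | _) (_ | _) <;> simp [borderedMatrix]

theorem transpose_borderedMatrix (r : ℝ) (v : Fin n → ℝ) (M : Matrix (Fin n) (Fin n) ℝ) :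
    (borderedMatrix r v M)ᵀ = borderedMatrix r v Mᵀ := by
  ext (_ | _) (_ | _) <;> simp [borderedMatrix]

theorem borderedMatrix_zero : borderedMatrix 0 (0 : Fin n → ℝ) 0 = 0 := by
  ext (_ | _) (_ | _) <;> simp [borderedMatrix]

theorem borderedMatrix_eq_zero_iff {r : ℝ} {v : Fin n → ℝ} {M : Matrix (Fin n) (Fin n) ℝ} :
    borderedMatrix r v M = 0 ↔ r = 0 ∧ v = 0 ∧ M = 0 := by
  refine ⟨fun h ↦ ⟨congrFun₂ h (.inl ()) (.inl ()), funext fun i ↦ congrFun₂ h (.inl ()) (.inr i),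
    ext fun i j ↦ congrFun₂ h (.inr i) (.inr j)⟩, ?_⟩
  rintro ⟨rfl, rfl, rfl⟩
  exact borderedMatrix_zero

@[fun_prop]
theorem Continuous.borderedMatrix {T : Type*} [TopologicalSpace T] {r : T → ℝ}
    {v : T → Fin n → ℝ} {M : T → Matrix (Fin n) (Fin n) ℝ} (hr : Continuous r)
    (hv : Continuous v) (hM : Continuous M) :
    Continuous fun t ↦ borderedMatrix (r t) (v t) (M t) := by
  refine continuous_matrix fun k l ↦ ?_
  rcases k with _ | k <;> rcases l with _ | l <;> simp [_root_.borderedMatrix] <;> fun_prop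

theorem trace_transpose_borderedMatrix_mul (r s : ℝ) (v w : Fin n → ℝ)
    (M N : Matrix (Fin n) (Fin n) ℝ) :
    ((borderedMatrix r v M)ᵀ * borderedMatrix s w N).trace
      = r * s + 2 * (v ⬝ᵥ w) + (Mᵀ * N).trace := by
  simp only [trace_transpose_mul_eq_sum, Fintype.sum_sum_type, borderedMatrix, dotProduct,
    fromBlocks_apply₁₁, fromBlocks_apply₁₂, fromBlocks_apply₂₁, fromBlocks_apply₂₂, of_apply,
    replicateRow_apply, replicateCol_apply, Finset.univ_unique, Finset.sum_singleton,
    Finset.sum_add_distrib]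
  ring

theorem vecMulVec_self_eq_borderedMatrix (s : Unit ⊕ Fin n → ℝ) :
    vecMulVec s s = borderedMatrix (s (.inl ()) * s (.inl ()))
      (s (.inl ()) • fun i ↦ s (.inr i)) (vecMulVec (fun i ↦ s (.inr i)) fun i ↦ s (.inr i)) := by
  ext (_ | _) (_ | _) <;> simp [borderedMatrix, vecMulVec_apply, mul_comm]

end BorderedMatrix

namespace MBQPData

variable {n m : ℕ}

/-! ### Weak duality -/

theorem transpose_dualSlack (P : MBQPData n m) (hQ : P.Q.IsSymm) (Ψ : P.DualVar) :
    (P.dualSlack Ψ)ᵀ = P.dualSlack Ψ := by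
  simp [dualSlack, transpose_sub, transpose_sum, transpose_smul, transpose_borderedMatrix,
    transpose_vecMulVec, hQ.eq]

/-- The identity that defines the dual: the inner product of the dual slack matrix with a
bordered matrix is the Lagrangian. -/
theorem trace_transpose_dualSlack_mul (P : MBQPData n m) (Ψ : P.DualVar) (r : ℝ) (x : Fin n → ℝ)
    (X : Matrix (Fin n) (Fin n) ℝ) :
    ((P.dualSlack Ψ)ᵀ * borderedMatrix r x X).trace
      = P.primalObj (x, X) - ∑ j, Ψ.γ j * (P.a j ⬝ᵥ x)
        - ∑ j, Ψ.ω j * (vecMulVec (P.a j) (P.a j) * X).trace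
        - ∑ i, Ψ.κ i * (x i - X i i) - ∑ i, Ψ.φ i * X i i - Ψ.μ * r := by
  simp only [dualSlack, transpose_sub, transpose_sum, transpose_smul, sub_mul, Finset.sum_mul,
    smul_mul, trace_sub, trace_sum, trace_smul, trace_transpose_borderedMatrix_mul, smul_eq_mul,
    smul_dotProduct, primalObj, transpose_vecMulVec, single_dotProduct, transpose_neg, neg_mul,
    trace_neg, transpose_single, trace_single_mul, transpose_zero, zero_mul, trace_zero,
    zero_dotProduct]
  ring_nf

theorem dualObj_le_primalObj (P : MBQPData n m) {b : Fin m → ℝ} {Ψ : P.DualVar}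
    (hΨ : Ψ ∈ P.dualFeas) {p : (Fin n → ℝ) × Matrix (Fin n) (Fin n) ℝ}
    (hp : p ∈ P.primalFeas b) : P.dualObj b Ψ ≤ P.primalObj p := by
  obtain ⟨hslack, hφ, hΘ, hΩ⟩ := hΨ
  obtain ⟨x, X⟩ := p
  obtain ⟨h1, h2, h3, h4, h5, h6⟩ := hp
  have hL := P.trace_transpose_dualSlack_mul Ψ 1 x X
  have hnn : 0 ≤ ((P.dualSlack Ψ)ᵀ * borderedMatrix 1 x X).trace := by
    rw [hslack, transpose_add, add_mul, trace_add]
    refine add_nonneg ?_ (hΩ.trace_transpose_mul_nonneg h5)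
    rw [trace_transpose_mul_eq_sum]
    exact Finset.sum_nonneg fun k _ ↦ Finset.sum_nonneg fun l _ ↦ mul_nonneg (hΘ k l) (h6 k l)
  have hφX : ∑ i, P.U i ^ 2 * Ψ.φ i ≤ ∑ i, Ψ.φ i * X i i := by
    refine Finset.sum_le_sum fun i _ ↦ ?_
    rw [mul_comm]
    exact mul_le_mul_of_nonpos_left (h4 i) (hφ i)
  have hκ : ∑ i, Ψ.κ i * (x i - X i i) = 0 :=
    Finset.sum_eq_zero fun i _ ↦ by
      rw [show x i = X i i from h3 i i.2, sub_self, mul_zero]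
  rw [hκ] at hL
  simp only [h1, h2] at hL
  rw [dualObj, Finset.sum_add_distrib]
  linarith

theorem dualObj_le_primalValue (P : MBQPData n m) {b : Fin m → ℝ} {Ψ : P.DualVar}
    (hΨ : Ψ ∈ P.dualFeas) (hb : (P.primalFeas b).Nonempty) :
    P.dualObj b Ψ ≤ P.primalValue b := by
  refine le_csInf (hb.image _) ?_
  rintro _ ⟨p, hp, rfl⟩
  exact P.dualObj_le_primalObj hΨ hp

/-! ### Attainment of the primal minimum -/

@[fun_prop]
theorem continuous_primalObj (P : MBQPData n m) : Continuous P.primalObj := by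
  unfold primalObj
  fun_prop

/-- For binary `i` the constraint `x_i = X_ii` and the minor of `Y` at the indices `0, i` give
`X_ii ≤ 1`; the other diagonal entries are bounded by `U_i²`. So the diagonal of `Y`, and hence
all of `Y`, is bounded. -/
theorem isCompact_primalFeas (P : MBQPData n m) (b : Fin m → ℝ) : IsCompact (P.primalFeas b) := by
  have hclosed : IsClosed (P.primalFeas b) := by
    simp only [primalFeas, ofPred_and, ofPred_forall]
    refine .inter (isClosed_iInter fun j ↦ isClosed_eq (by fun_prop) (by fun_prop)) <|
      .inter (isClosed_iInter fun j ↦ isClosed_eq (by fun_prop) (by fun_prop)) <|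
      .inter (isClosed_iInter fun i ↦ isClosed_iInter fun _ ↦
        isClosed_eq (by fun_prop) (by fun_prop)) <|
      .inter (isClosed_iInter fun i ↦ isClosed_le (by fun_prop) (by fun_prop)) <|
      .inter (isClosed_setOf_posSemidef.preimage (by fun_prop)) <|
      isClosed_iInter fun k ↦ isClosed_iInter fun l ↦ isClosed_le (by fun_prop) ?_
    have : Continuous fun p : (Fin n → ℝ) × Matrix (Fin n) (Fin n) ℝ ↦
      borderedMatrix 1 p.1 p.2 := by fun_prop
    exact this.matrix_elem k l
  set D : ℝ := 1 + ∑ i, P.U i ^ 2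
  have hUD : 0 ≤ ∑ i, P.U i ^ 2 := Finset.sum_nonneg fun i _ ↦ sq_nonneg _
  have hbox : IsCompact ((univ.pi fun _ : Fin n ↦ Icc (-D) D) ×ˢ
      (univ.pi fun _ : Fin n ↦ univ.pi fun _ : Fin n ↦ Icc (-D) D :
        Set (Matrix (Fin n) (Fin n) ℝ))) :=
    (isCompact_univ_pi fun _ ↦ isCompact_Icc).prod
      (isCompact_univ_pi fun _ ↦ isCompact_univ_pi fun _ ↦ isCompact_Icc)
  refine hbox.of_isClosed_subset hclosed ?_
  rintro ⟨x, X⟩ ⟨-, -, h3, h4, h5, -⟩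
  have hdiag : ∀ i, X i i ≤ D := fun i ↦ by
    by_cases hi : i ∈ P.B
    · have h : x i ≤ (1 + X i i) / 2 :=
        (le_abs_self _).trans (h5.abs_apply_le (.inl ()) (.inr i))
      have hxi : x i = X i i := h3 i hi
      linarith
    · have := Finset.single_le_sum (f := fun i ↦ P.U i ^ 2) (fun i _ ↦ sq_nonneg _)
        (Finset.mem_univ ⟨i, hi⟩)
      have hXi : X i i ≤ P.U ⟨i, hi⟩ ^ 2 := h4 ⟨i, hi⟩
      linarith
  refine ⟨fun i _ ↦ ?_, fun i _ j _ ↦ ?_⟩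
  · have h : |x i| ≤ (1 + X i i) / 2 := h5.abs_apply_le (.inl ()) (.inr i)
    exact abs_le.1 (by linarith [hdiag i] : |x i| ≤ D)
  · have h : |X i j| ≤ (X i i + X j j) / 2 := h5.abs_apply_le (.inr i) (.inr j)
    exact abs_le.1 (by linarith [hdiag i, hdiag j] : |X i j| ≤ D)

theorem isLeast_primalValue (P : MBQPData n m) {b : Fin m → ℝ} (hb : (P.primalFeas b).Nonempty) :
    IsLeast (P.primalObj '' P.primalFeas b) (P.primalValue b) :=
  ((P.isCompact_primalFeas b).image P.continuous_primalObj).isLeast_sInf (hb.image _)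

/-! ### Strong duality -/

open scoped Matrix.Norms.Elementwise

/-- The space of lifted primal points `(r, x, X, Z, t, s)`: the matrix `Y = [[r, xᵀ], [x, X]]`, a
second copy `Z` of it, slacks `t` for the upper bounds on `X_ii`, and a slack `s` for the
objective. The copy `Z` separates the two cone constraints `Y ⪰ 0` and `Y ≥ 0`, so that each of
them receives its own multiplier. -/
abbrev LiftedPoint (P : MBQPData n m) : Type :=
  ℝ × (Fin n → ℝ) × Matrix (Fin n) (Fin n) ℝ × Matrix (Unit ⊕ Fin n) (Unit ⊕ Fin n) ℝ ×
    ({i : Fin n // i ∉ P.B} → ℝ) × ℝ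

/-- The cone `Y ⪰ 0`, `Z ≥ 0`, `t ≥ 0`, `s ≥ 0` of lifted points. -/
def liftedCone (P : MBQPData n m) : PointedCone ℝ P.LiftedPoint where
  carrier := {w | (borderedMatrix w.1 w.2.1 w.2.2.1).PosSemidef ∧ (∀ k l, 0 ≤ w.2.2.2.1 k l) ∧
    (∀ i, 0 ≤ w.2.2.2.2.1 i) ∧ 0 ≤ w.2.2.2.2.2}
  add_mem' := by
    rintro u v ⟨h1, h2, h3, h4⟩ ⟨k1, k2, k3, k4⟩
    refine ⟨?_, fun k l ↦ add_nonneg (h2 k l) (k2 k l), fun i ↦ add_nonneg (h3 i) (k3 i),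
      add_nonneg h4 k4⟩
    simpa only [Prod.fst_add, Prod.snd_add, borderedMatrix_add] using h1.add k1
  zero_mem' := by
    refine ⟨?_, fun k l ↦ le_rfl, fun i ↦ le_rfl, le_rfl⟩
    simpa only [Prod.fst_zero, Prod.snd_zero, borderedMatrix_zero] using PosSemidef.zero
  smul_mem' := by
    rintro ⟨c, hc⟩ u ⟨h1, h2, h3, h4⟩
    refine ⟨?_, fun k l ↦ mul_nonneg hc (h2 k l), fun i ↦ mul_nonneg hc (h3 i),
      mul_nonneg hc h4⟩
    have := h1.smul hc
    rwa [← borderedMatrix_smul] at this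

theorem isClosed_liftedCone (P : MBQPData n m) : IsClosed (P.liftedCone : Set P.LiftedPoint) := by
  have h : (P.liftedCone : Set P.LiftedPoint) = {w |
    (borderedMatrix w.1 w.2.1 w.2.2.1).PosSemidef ∧ (∀ k l, 0 ≤ w.2.2.2.1 k l) ∧
    (∀ i, 0 ≤ w.2.2.2.2.1 i) ∧ 0 ≤ w.2.2.2.2.2} := rfl
  rw [h]
  simp only [ofPred_and, ofPred_forall]
  exact .inter (isClosed_setOf_posSemidef.preimage (by fun_prop)) <|
    .inter (isClosed_iInter fun k ↦ isClosed_iInter fun l ↦ isClosed_le (by fun_prop)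
      (Continuous.matrix_elem (by fun_prop) k l)) <|
    .inter (isClosed_iInter fun i ↦ isClosed_le (by fun_prop) (by fun_prop)) <|
    isClosed_le (by fun_prop) (by fun_prop)

/-- Index type of the constraints on lifted points, one index for each dual multiplier: those of
the linear equations, the lifted equations, the binary conditions, the upper bounds, `Y₀₀ = 1`,
the objective, and `Y = Z`. -/
abbrev ConstraintIndex (P : MBQPData n m) : Type :=
  Fin m ⊕ Fin m ⊕ {i : Fin n // i ∈ P.B} ⊕ {i : Fin n // i ∉ P.B} ⊕ Unit ⊕ Unit ⊕
    ((Unit ⊕ Fin n) × (Unit ⊕ Fin n))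

/-- Left-hand sides of all constraints on a lifted point, the objective included. -/
def constraintMap (P : MBQPData n m) : P.LiftedPoint →ₗ[ℝ] P.ConstraintIndex → ℝ where
  toFun w := Sum.elim (fun j ↦ P.a j ⬝ᵥ w.2.1) <|
    Sum.elim (fun j ↦ (vecMulVec (P.a j) (P.a j) * w.2.2.1).trace) <|
    Sum.elim (fun i ↦ w.2.1 i - w.2.2.1 i i) <|
    Sum.elim (fun i ↦ w.2.2.1 i i + w.2.2.2.2.1 i) <|
    Sum.elim (fun _ ↦ w.1) <|
    Sum.elim (fun _ ↦ P.primalObj (w.2.1, w.2.2.1) + w.2.2.2.2.2) fun k ↦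
      borderedMatrix w.1 w.2.1 w.2.2.1 k.1 k.2 - w.2.2.2.1 k.1 k.2
  map_add' u v := by
    ext (_ | _ | _ | _ | _ | _ | _) <;>
      simp [dotProduct_add, mul_add, borderedMatrix_add, primalObj] <;> ring
  map_smul' c u := by
    ext (_ | _ | _ | _ | _ | _ | _) <;>
      simp [primalObj, borderedMatrix_smul] <;> ring

/-- Right-hand sides of all constraints, with `v` as the bound on the objective. -/
def constraintRhs (P : MBQPData n m) (b : Fin m → ℝ) (v : ℝ) : P.ConstraintIndex → ℝ :=
  Sum.elim b <| Sum.elim (fun j ↦ b j ^ 2) <| Sum.elim 0 <| Sum.elim (fun i ↦ P.U i ^ 2) <|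
    Sum.elim 1 <| Sum.elim (fun _ ↦ v) 0

/-- The relaxation has no nonzero recession direction. If `Y₀₀ = 0` then `x_i ≤ X_ii / 2`, so
`x_i = X_ii` forces `X_ii = 0` for binary `i`; for the other `i` this is the homogeneous upper
bound. A positive semidefinite matrix with zero diagonal is zero. -/
theorem eq_zero_of_constraintMap_eq_zero (P : MBQPData n m) (w : P.LiftedPoint)
    (hw : w ∈ P.liftedCone) (h : P.constraintMap w = 0) : w = 0 := by
  obtain ⟨r, x, X, Z, t, s⟩ := w
  obtain ⟨h1, h2, h3, h4⟩ := hw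
  change (borderedMatrix r x X).PosSemidef at h1
  change ∀ i, 0 ≤ t i at h3
  have hκ : ∀ i : {i : Fin n // i ∈ P.B}, x i - X i i = 0 :=
    fun i ↦ congrFun h (.inr (.inr (.inl i)))
  have hφ : ∀ i : {i : Fin n // i ∉ P.B}, X i i + t i = 0 :=
    fun i ↦ congrFun h (.inr (.inr (.inr (.inl i))))
  have hr : r = 0 := congrFun h (.inr (.inr (.inr (.inr (.inl ())))))
  have hs : P.primalObj (x, X) + s = 0 := congrFun h (.inr (.inr (.inr (.inr (.inr (.inl ()))))))
  have hZ : ∀ k l, borderedMatrix r x X k l - Z k l = 0 :=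
    fun k l ↦ congrFun h (.inr (.inr (.inr (.inr (.inr (.inr (k, l)))))))
  have hX : ∀ i, 0 ≤ X i i := fun i ↦ h1.diag_nonneg (i := .inr i)
  have hdiag : ∀ i, X i i = 0 := fun i ↦ by
    by_cases hi : i ∈ P.B
    · have hx : x i ≤ (r + X i i) / 2 :=
        (le_abs_self _).trans (h1.abs_apply_le (.inl ()) (.inr i))
      have := hκ ⟨i, hi⟩
      simp only at this
      linarith [hX i]
    · have := hφ ⟨i, hi⟩
      have := h3 ⟨i, hi⟩
      simp only at *
      linarith [hX i]
  have hY : borderedMatrix r x X = 0 := 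
    h1.eq_zero_of_diag_eq_zero (by rintro (_ | i); exacts [hr, hdiag i])
  have hZ0 : Z = 0 := by
    ext k l
    have := hZ k l
    rw [hY] at this
    simpa using this
  obtain ⟨-, rfl, rfl⟩ := borderedMatrix_eq_zero_iff.1 hY
  have ht : t = 0 := funext fun i ↦ by simpa using hφ i
  have hs0 : s = 0 := by simpa [primalObj] using hs
  simp [hr, hZ0, ht, hs0]

theorem exists_primalObj_le_of_constraintMap_eq (P : MBQPData n m) {b : Fin m → ℝ} {v : ℝ}
    {w : P.LiftedPoint} (hw : w ∈ P.liftedCone) (h : P.constraintMap w = P.constraintRhs b v) :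
    ∃ p ∈ P.primalFeas b, P.primalObj p ≤ v := by
  obtain ⟨r, x, X, Z, t, s⟩ := w
  obtain ⟨h1, h2, h3, h4⟩ := hw
  change (borderedMatrix r x X).PosSemidef at h1
  change ∀ k l, 0 ≤ Z k l at h2
  change ∀ i, 0 ≤ t i at h3
  change 0 ≤ s at h4
  have hκ : ∀ i : {i : Fin n // i ∈ P.B}, x i - X i i = 0 :=
    fun i ↦ congrFun h (.inr (.inr (.inl i)))
  have hφ : ∀ i : {i : Fin n // i ∉ P.B}, X i i + t i = P.U i ^ 2 :=
    fun i ↦ congrFun h (.inr (.inr (.inr (.inl i))))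
  have hr : r = 1 := congrFun h (.inr (.inr (.inr (.inr (.inl ())))))
  have hs : P.primalObj (x, X) + s = v := congrFun h (.inr (.inr (.inr (.inr (.inr (.inl ()))))))
  have hZ : ∀ k l, borderedMatrix r x X k l - Z k l = 0 :=
    fun k l ↦ congrFun h (.inr (.inr (.inr (.inr (.inr (.inr (k, l)))))))
  subst hr
  refine ⟨(x, X), ⟨fun j ↦ congrFun h (.inl j), fun j ↦ congrFun h (.inr (.inl j)),
    fun i hi ↦ sub_eq_zero.1 (hκ ⟨i, hi⟩), fun i ↦ ?_, h1, fun k l ↦ ?_⟩, by linarith⟩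
  · linarith [hφ i, h3 i]
  · exact (sub_eq_zero.1 (hZ k l)).symm ▸ h2 k l

/-- Unnormalized multipliers from Farkas' lemma; `ρ` is the multiplier of the objective. -/
theorem exists_multipliers (P : MBQPData n m) {b : Fin m → ℝ} {v : ℝ}
    (hv : ∀ p ∈ P.primalFeas b, v < P.primalObj p) :
    ∃ (γ ω : Fin m → ℝ) (κ : {i : Fin n // i ∈ P.B} → ℝ) (φ : {i : Fin n // i ∉ P.B} → ℝ)
      (μ ρ : ℝ) (S : Matrix (Unit ⊕ Fin n) (Unit ⊕ Fin n) ℝ),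
      (∀ (r : ℝ) (x : Fin n → ℝ) (X : Matrix (Fin n) (Fin n) ℝ)
        (Z : Matrix (Unit ⊕ Fin n) (Unit ⊕ Fin n) ℝ) (t : {i : Fin n // i ∉ P.B} → ℝ) (s : ℝ),
        (borderedMatrix r x X).PosSemidef → (∀ k l, 0 ≤ Z k l) → (∀ i, 0 ≤ t i) →
        0 ≤ s → 0 ≤ ∑ j, P.a j ⬝ᵥ x * γ j + ∑ j, (vecMulVec (P.a j) (P.a j) * X).trace * ω j
          + ∑ i : {i : Fin n // i ∈ P.B}, (x i - X i i) * κ i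
          + ∑ i : {i : Fin n // i ∉ P.B}, (X i i + t i) * φ i + r * μ
          + (P.primalObj (x, X) + s) * ρ + ∑ k, ∑ l, (borderedMatrix r x X k l - Z k l) * S k l) ∧
      ∑ j, b j * γ j + ∑ j, b j ^ 2 * ω j + ∑ i, P.U i ^ 2 * φ i + μ + v * ρ < 0 := by
  obtain ⟨y, hy, hyv⟩ := P.liftedCone.exists_separating_vector P.isClosed_liftedCone
    P.constraintMap P.eq_zero_of_constraintMap_eq_zero (z := P.constraintRhs b v)
    fun w hw h ↦ by
      obtain ⟨p, hp, hpv⟩ := P.exists_primalObj_le_of_constraintMap_eq hw h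
      exact (hv p hp).not_ge hpv
  refine ⟨fun j ↦ y (.inl j), fun j ↦ y (.inr (.inl j)), fun i ↦ y (.inr (.inr (.inl i))),
    fun i ↦ y (.inr (.inr (.inr (.inl i)))), y (.inr (.inr (.inr (.inr (.inl ()))))),
    y (.inr (.inr (.inr (.inr (.inr (.inl ())))))),
    .of fun k l ↦ y (.inr (.inr (.inr (.inr (.inr (.inr (k, l))))))), ?_, ?_⟩
  · intro r x X Z t s h1 h2 h3 h4
    have := hy (r, x, X, Z, t, s) ⟨h1, h2, h3, h4⟩
    simp only [constraintMap, LinearMap.coe_mk, AddHom.coe_mk, Fintype.sum_sum_type, Sum.elim_inl,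
      Sum.elim_inr, Finset.univ_unique, Finset.sum_singleton, Fintype.sum_prod_type] at this
    simp only [Fintype.sum_sum_type, Finset.univ_unique, Finset.sum_singleton, of_apply]
    convert this using 1
    simp only [PUnit.default_eq_unit]
    ring
  · simp only [constraintRhs, Fintype.sum_sum_type, Sum.elim_inl, Sum.elim_inr,
      Finset.univ_unique, Finset.sum_singleton, Pi.zero_apply, zero_mul, Finset.sum_const_zero,
      Pi.one_apply, one_mul, add_zero, zero_add] at hyv
    simp only [PUnit.default_eq_unit] at hyv
    linarith

/-- Absence of a duality gap: dual feasible points come arbitrarily close to the primal minimum.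
Feasibility of the relaxation makes the multiplier `ρ` of the objective positive; after division
by `ρ` the multiplier of `Y = Z` is `-Θ`. -/
theorem exists_dualFeas_lt_dualObj (P : MBQPData n m) (hQ : P.Q.IsSymm) {b : Fin m → ℝ} {v : ℝ}
    (hb : (P.primalFeas b).Nonempty) (hv : ∀ p ∈ P.primalFeas b, v < P.primalObj p) :
    ∃ Ψ ∈ P.dualFeas, v < P.dualObj b Ψ := by
  obtain ⟨γ, ω, κ, φ, μ, ρ, S, hL, hlt⟩ := P.exists_multipliers hv
  have hρ : 0 < ρ := by
    obtain ⟨⟨x, X⟩, hp⟩ := hb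
    have hpv := hv _ hp
    obtain ⟨h1, h2, h3, h4, h5, h6⟩ := hp
    have h := hL 1 x X (borderedMatrix 1 x X) (fun i ↦ P.U i ^ 2 - X i i) 0 h5 h6
      (fun i ↦ sub_nonneg.2 (h4 i)) le_rfl
    have hκ : ∑ i : {i // i ∈ P.B}, (x i - X i i) * κ i = 0 :=
      Finset.sum_eq_zero fun i _ ↦ by
        rw [show x i = X i i from h3 i i.2, sub_self, zero_mul]
    rw [hκ] at h
    simp only [h1, h2, add_sub_cancel, sub_self, zero_mul, Finset.sum_const_zero] at h
    refine pos_of_mul_pos_right (a := P.primalObj (x, X) - v) ?_ (sub_pos.2 hpv).le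
    linarith
  have hφ : ∀ i, 0 ≤ φ i := fun i ↦ by
    have h := hL 0 0 0 0 (Pi.single i 1) 0 (by rw [borderedMatrix_zero]; exact .zero)
      (fun _ _ ↦ le_rfl) (fun k ↦ by by_cases hk : k = i <;> simp [hk]) le_rfl
    simpa [borderedMatrix_zero, primalObj, Pi.single_apply] using h
  have hS : ∀ k l, S k l ≤ 0 := fun k l ↦ by
    have h := hL 0 0 0 (Matrix.single k l 1) 0 0 (by rw [borderedMatrix_zero]; exact .zero)
      (fun i j ↦ by by_cases hk : k = i ∧ l = j <;> simp [hk])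
      (fun _ ↦ le_rfl) le_rfl
    rw [borderedMatrix_zero] at h
    simp only [Matrix.zero_apply, zero_sub, neg_mul, Finset.sum_neg_distrib] at h
    have hsum : ∑ i, ∑ j, Matrix.single k l (1 : ℝ) i j * S i j = S k l := by
      rw [Finset.sum_eq_single k, Finset.sum_eq_single l]
      · simp
      · intro j _ hj
        simp [hj.symm]
      · simp
      · intro i _ hi
        simp [hi.symm]
      · simp
    rw [hsum] at h
    simpa [primalObj] using h
  have hscale : ∀ {ι : Type} [Fintype ι] (f g : ι → ℝ),
      ∑ i, -(g i / ρ) * f i = -(∑ i, f i * g i) / ρ := fun f g ↦ by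
    rw [neg_div, Finset.sum_div, ← Finset.sum_neg_distrib]
    exact Finset.sum_congr rfl fun i _ ↦ by ring
  -- `S` need not be symmetric, but `Ω` and the slack matrix are, so `Θ` has to be symmetrized.
  let Θ : Matrix (Unit ⊕ Fin n) (Unit ⊕ Fin n) ℝ := .of fun k l ↦ -(S k l + S l k) / (2 * ρ)
  let Ψ₀ : P.DualVar := ⟨fun j ↦ -(γ j / ρ), fun j ↦ -(ω j / ρ), fun i ↦ -(φ i / ρ),
    fun i ↦ -(κ i / ρ), -(μ / ρ), 0, Θ⟩
  let Ψ : P.DualVar := { Ψ₀ with Ω := P.dualSlack Ψ₀ - Θ }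
  have hΘsymm : Θᵀ = Θ := by
    ext k l
    simp only [Θ, transpose_apply, of_apply, add_comm]
  refine ⟨Ψ, ⟨?_, fun i ↦ ?_, fun k l ↦ ?_, ?_⟩, ?_⟩
  · exact (add_sub_cancel Θ (P.dualSlack Ψ₀)).symm
  · exact neg_nonpos.2 (div_nonneg (hφ i) hρ.le)
  · exact div_nonneg (by linarith [hS k l, hS l k]) (by positivity)
  · refine .of_dotProduct_mulVec_nonneg ?_ fun u ↦ ?_
    · change (P.dualSlack Ψ₀ - Θ)ᵀ = P.dualSlack Ψ₀ - Θ
      rw [transpose_sub, hΘsymm, P.transpose_dualSlack hQ]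
    · change 0 ≤ u ⬝ᵥ (P.dualSlack Ψ₀ - Θ) *ᵥ u
      rw [← trace_transpose_mul_vecMulVec, transpose_sub, sub_mul, trace_sub,
        trace_transpose_mul_eq_sum Θ]
      have hpsd : (vecMulVec u u).PosSemidef := by simpa using posSemidef_vecMulVec_self_star u
      have hΘ : ∑ k, ∑ l, Θ k l * vecMulVec u u k l
          = -(∑ k, ∑ l, vecMulVec u u k l * S k l) / ρ := by
        have hcomm : ∑ k, ∑ l, u k * u l * S l k = ∑ k, ∑ l, u k * u l * S k l := by
          rw [Finset.sum_comm]
          simp only [mul_comm (u _) (u _)]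
        have hsum : ∑ k, ∑ l, Θ k l * vecMulVec u u k l
            = -(∑ k, ∑ l, u k * u l * S k l + ∑ k, ∑ l, u k * u l * S l k) / (2 * ρ) := by
          simp only [← Finset.sum_add_distrib, ← Finset.sum_neg_distrib, Finset.sum_div]
          refine Finset.sum_congr rfl fun k _ ↦ Finset.sum_congr rfl fun l _ ↦ ?_
          simp only [Θ, of_apply, vecMulVec_apply]
          ring
        rw [hsum, hcomm]
        simp only [vecMulVec_apply]
        field_simp
        ring
      rw [hΘ]
      rw [vecMulVec_self_eq_borderedMatrix] at hpsd ⊢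
      rw [trace_transpose_dualSlack_mul]
      have h := hL _ _ _ 0 0 0 hpsd (fun _ _ ↦ le_rfl) (fun _ ↦ le_rfl) le_rfl
      simp only [Matrix.zero_apply, sub_zero, Pi.zero_apply, add_zero] at h
      simp only [Ψ₀, hscale]
      refine (div_nonneg h hρ.le).trans_eq ?_
      field_simp
      ring
  · have h1 : P.dualObj b Ψ
        = -(∑ j, b j * γ j + ∑ j, b j ^ 2 * ω j + ∑ i, P.U i ^ 2 * φ i + μ) / ρ := by
      simp only [dualObj, Ψ, Ψ₀, Finset.sum_add_distrib, hscale, mul_comm (P.U _ ^ 2)]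
      simp only [mul_comm (φ _)]
      field_simp
      ring
    rw [h1, lt_div_iff₀ hρ]
    linarith

theorem dualObj_eq_primalValue (P : MBQPData n m) (hQ : P.Q.IsSymm) {b : Fin m → ℝ}
    (hb : (P.primalFeas b).Nonempty) {Ψ : P.DualVar} (hΨ : Ψ ∈ P.dualOpt b) :
    P.dualObj b Ψ = P.primalValue b := by
  refine (P.dualObj_le_primalValue hΨ.1 hb).antisymm (le_of_forall_lt fun v hv ↦ ?_)
  obtain ⟨Ψ', hΨ', hlt⟩ := P.exists_dualFeas_lt_dualObj hQ hb (v := v) fun p hp ↦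
    hv.trans_le ((P.isLeast_primalValue hb).2 ⟨p, hp, rfl⟩)
  exact hlt.trans_le (hΨ.2 Ψ' hΨ')

/-! ### Sensitivity -/

theorem differentiableAt_dualFun (P : MBQPData n m) {b : Fin m → ℝ → ℝ} {θ : ℝ}
    (hb : ∀ j, DifferentiableAt ℝ (b j) θ) (Ψ : P.DualVar) :
    DifferentiableAt ℝ (P.dualFun b Ψ) θ := by
  unfold dualFun dualObj
  fun_prop

end MBQPData

/-- If `g ≤ f` on a left neighbourhood of `θ` with equality at `θ`, the difference quotients of
`f` from the left are at most those of `g`. -/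
theorem HasDerivWithinAt.le_of_eventually_le_left {f g : ℝ → ℝ} {L D θ : ℝ}
    (hf : HasDerivWithinAt f L (Iio θ) θ) (hg : HasDerivWithinAt g D (Iio θ) θ)
    (h : ∀ᶠ t in 𝓝[<] θ, g t ≤ f t) (hθ : g θ = f θ) : L ≤ D := by
  rw [hasDerivWithinAt_iff_tendsto_slope' self_notMem_Iio] at hf hg
  refine le_of_tendsto_of_tendsto hf hg ?_
  filter_upwards [h, self_mem_nhdsWithin] with t ht htθ
  rw [slope_def_field, slope_def_field, hθ]
  exact div_le_div_of_nonpos_of_le (sub_nonpos.2 (le_of_lt htθ)) (by linarith)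

theorem HasDerivWithinAt.le_of_eventually_le_right {f g : ℝ → ℝ} {R D θ : ℝ}
    (hf : HasDerivWithinAt f R (Ioi θ) θ) (hg : HasDerivWithinAt g D (Ioi θ) θ)
    (h : ∀ᶠ t in 𝓝[>] θ, g t ≤ f t) (hθ : g θ = f θ) : D ≤ R := by
  rw [hasDerivWithinAt_iff_tendsto_slope' self_notMem_Ioi] at hf hg
  refine le_of_tendsto_of_tendsto hg hf ?_
  filter_upwards [h, self_mem_nhdsWithin] with t ht htθ
  rw [slope_def_field, slope_def_field, hθ]
  exact div_le_div_of_nonneg_right (by linarith) (sub_nonneg.2 (le_of_lt htθ))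

theorem theorem1 {n m : ℕ} (P : MBQPData n m) (hQ : P.Q.PosSemidef)
    (b : Fin m → ℝ → ℝ) (θlo θhi : ℝ)
    (hb : ∀ j, ∀ t ∈ Set.Icc θlo θhi, DifferentiableAt ℝ (b j) t)
    (hfeas : ∀ t ∈ Set.Icc θlo θhi, (P.primalFeas (fun j => b j t)).Nonempty) :
    -- the minimum that defines `V^SDP` is attained on the interval
    (∀ t ∈ Set.Icc θlo θhi,
      IsLeast (P.primalObj '' P.primalFeas (fun j => b j t)) (P.valueFun b t)) ∧
    ∀ θ ∈ Set.Icc θlo θhi, ∀ Ψ ∈ P.dualOpt (fun j => b j θ),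
      DifferentiableAt ℝ (P.dualFun b Ψ) θ ∧
      -- left derivative
      (θlo < θ → ∀ L : ℝ, HasDerivWithinAt (P.valueFun b) L (Set.Iio θ) θ →
        L ≤ deriv (P.dualFun b Ψ) θ) ∧
      -- right derivative
      (θ < θhi → ∀ R : ℝ, HasDerivWithinAt (P.valueFun b) R (Set.Ioi θ) θ →
        deriv (P.dualFun b Ψ) θ ≤ R) ∧
      -- two-sided derivative; the first hypothesis is automatic for `θlo < θ < θhi`
      (P.feasDomain b ∈ 𝓝 θ → ∀ D : ℝ, HasDerivAt (P.valueFun b) D θ →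
        D = deriv (P.dualFun b Ψ) θ) := by
  refine ⟨fun t ht ↦ P.isLeast_primalValue (hfeas t ht), fun θ hθ Ψ hΨ ↦ ?_⟩
  have hQs : P.Q.IsSymm := hQ.isHermitian
  have hdiff := P.differentiableAt_dualFun (fun j ↦ hb j θ hθ) Ψ
  have heq : P.dualFun b Ψ θ = P.valueFun b θ := P.dualObj_eq_primalValue hQs (hfeas θ hθ) hΨ
  have hle : ∀ t ∈ P.feasDomain b, P.dualFun b Ψ t ≤ P.valueFun b t :=
    fun t ht ↦ P.dualObj_le_primalValue hΨ.1 ht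
  refine ⟨hdiff, fun hlo L hL ↦ ?_, fun hhi R hR ↦ ?_, fun hdom D hD ↦ ?_⟩
  · refine hL.le_of_eventually_le_left hdiff.hasDerivAt.hasDerivWithinAt ?_ heq
    filter_upwards [Ioo_mem_nhdsLT hlo] with t ht
    exact hle t (hfeas t ⟨ht.1.le, ht.2.le.trans hθ.2⟩)
  · refine hR.le_of_eventually_le_right hdiff.hasDerivAt.hasDerivWithinAt ?_ heq
    filter_upwards [Ioo_mem_nhdsGT hhi] with t ht
    exact hle t (hfeas t ⟨hθ.1.trans ht.1.le, ht.2.le⟩)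
  · have hev : ∀ᶠ t in 𝓝 θ, P.dualFun b Ψ t ≤ P.valueFun b t :=
      Filter.mem_of_superset hdom hle
    exact le_antisymm
      (hD.hasDerivWithinAt.le_of_eventually_le_left hdiff.hasDerivAt.hasDerivWithinAt
        (hev.filter_mono nhdsWithin_le_nhds) heq)
      (hD.hasDerivWithinAt.le_of_eventually_le_right hdiff.hasDerivAt.hasDerivWithinAt
        (hev.filter_mono nhdsWithin_le_nhds) heq)
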